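/- Let $(X,Y)$ be a pair of random variables with values in measurable spaces $\mathcal X,\mathcal Y$ (discrete, continuous or general) and joint probability law $P$. A representation $Z$ of $X$ is given by a conditional distribution $p(z|x)$ (a Markov kernel from $\mathcal X$ to a standard Borel space), with $Z\leftarrow X\leftrightarrow Y$ a Markov chain. For $\beta\in\mathbb R$ let $\mathrm{IB}_\beta(X,Y;Z)=I(X;Z)-\beta\, I(Y;Z)$, where $I$ is mutual information. The pair $(X,Y)$ is *$\mathrm{IB}_\beta$-learnable* if there is a representation $Z$ with finite $I(X;Z)$ and $I(Y;Z)$ whose value of $\mathrm{IB}_\beta$ is strictly smaller than that of the trivial representation $p(z|x)=p(z)$ (for which $Z$ is independent of $X$). For a measurable $\Omega_x\subset\mathcal X$ let $p(\Omega_x)=P(X\in\Omega_x)$, and for $0<p(\Omega_x)<1$ let $$\beta_0(\Omega_x)=\frac{\frac1{p(\Omega_x)}-1}{\mathbb E_{y\sim p(y|\Omega_x)}\left[\frac{p(y|\Omega_x)}{p(y)}-1\right]}\in(0,\infty],$$ where $p(y|\Omega_x)$ is the conditional law of $Y$ given $X\in\Omega_x$, the quotient $p(y|\Omega_x)/p(y)$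 is its density with respect to the law of $Y$, and $\beta_0(\Omega_x)=\infty$ if the denominator is $0$. Let $\beta_0^{*}=\inf_{\Omega_x}\beta_0(\Omega_x)$ over all measurable $\Omega_x\subset\mathcal X$ with $0<p(\Omega_x)<1$ (with $\inf\emptyset=\infty$). Then: 1. If $X$ and $Y$ are not independent and $\beta>\beta_0^{*}$, then $(X,Y)$ is $\mathrm{IB}_\beta$-learnable. 2. $(\beta_0^{*})^{-1}$ (with $\infty^{-1}=0$) is a lower bound of the slope at the origin of the Pareto frontier of the information plane $I(Y;Z)$ vs. $I(X;Z)$: with $F(r)=\sup\{I(Y;Z): Z \text{ a representation of } X,\ I(X;Z)\le r\}$, $$\liminf_{r\downarrow 0}\frac{F(r)-F(0)}{r}\ \ge\ (\beta_0^{*})^{-1}.$$ 3. The condition is invariant under invertible maps of $X$: let $g:\mathcal X\to\mathcal X'$ be an injective measurable map that sends measurable sets to measurable sets (for example a measurable bijection with measurable inverse). Then $\beta_0(g(\Omega_x))$ computed for $(g(X),Y)$ equals $\beta_0(\Omega_x)$ computed for $(X,Y)$ for every measurable $\Omega_x\subset\mathcal X$ with $0<p(\Omega_x)<1$; the infimum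 $\beta_0^{*}$ is the same for $(g(X),Y)$ and $(X,Y)$; and for every $\beta$, the condition "$X$ and $Y$ are not independent and $\beta>\beta_0^{*}$" holds for $(g(X),Y)$ if and only if it holds for $(X,Y)$. -/

import Mathlib

open MeasureTheory ProbabilityTheory Filter Topology
open scoped ENNReal

noncomputable section

namespace IBLearn

/-- Mutual information (in nats) of a pair of random variables with joint law `μ`:
the Kullback-Leibler divergence from the product of the marginals to the joint law. -/
def mutualInfo {A B : Type*} [MeasurableSpace A] [MeasurableSpace B]
    (μ : Measure (A × B)) : ℝ≥0∞ :=
  InformationTheory.klDiv μ (μ.fst.prod μ.snd)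

/-- A (stochastic) representation `Z` of `X`: a standard Borel space of values (this covers finite,
countable and Euclidean-valued `Z`) with a conditional distribution `p(z|x)`, i.e. a Markov
kernel. -/
structure Representation (𝒳 : Type*) [MeasurableSpace 𝒳] where
  /-- The space of values of `Z`. -/
  Z : Type
  /-- The measurable structure on the values of `Z`. -/
  [measZ : MeasurableSpace Z]
  [borelZ : StandardBorelSpace Z]
  /-- The conditional distribution `p(z|x)`. -/
  encoder : Kernel 𝒳 Z
  [markov : IsMarkovKernel encoder]

attribute [instance] Representation.measZ Representation.borelZ Representation.markov

/-- The trivial representation with `p(z|x) = p(z)` the fixed distribution `q`, for every `x`. -/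
def trivialRep (𝒳 : Type*) [MeasurableSpace 𝒳] {Z : Type} [MeasurableSpace Z]
    [StandardBorelSpace Z] (q : Measure Z) [IsProbabilityMeasure q] : Representation 𝒳 where
  Z := Z
  encoder := Kernel.const 𝒳 q

variable {𝒳 𝒴 : Type*} [MeasurableSpace 𝒳] [MeasurableSpace 𝒴]

/-- The joint law of `((X, Y), Z)` when `(X, Y)` has law `P` and `Z` is drawn from `p(z|x)`
(so that `Z ← X ↔ Y` is a Markov chain). -/
def jointLaw (P : Measure (𝒳 × 𝒴)) (R : Representation 𝒳) : Measure ((𝒳 × 𝒴) × R.Z) :=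
  P ⊗ₘ (R.encoder.comap Prod.fst measurable_fst)

/-- `I(X;Z)`. -/
def infoXZ (P : Measure (𝒳 × 𝒴)) (R : Representation 𝒳) : ℝ≥0∞ :=
  mutualInfo ((jointLaw P R).map (fun w => (w.1.1, w.2)))

/-- `I(Y;Z)`. -/
def infoYZ (P : Measure (𝒳 × 𝒴)) (R : Representation 𝒳) : ℝ≥0∞ :=
  mutualInfo ((jointLaw P R).map (fun w => (w.1.2, w.2)))

/-- The information bottleneck objective `I(X;Z) - β I(Y;Z)`; it is used only for representations
for which both informations are finite. -/
def ibObjective (P : Measure (𝒳 × 𝒴)) (β : ℝ) (R : Representation 𝒳) : ℝ :=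
  (infoXZ P R).toReal - β * (infoYZ P R).toReal

/-- `(X, Y)` is `IB_β`-learnable: some representation (of finite information, so that the objective
is defined) has a strictly smaller objective than the trivial representations. -/
def Learnable (P : Measure (𝒳 × 𝒴)) (β : ℝ) : Prop :=
  ∃ R : Representation 𝒳, infoXZ P R ≠ ∞ ∧ infoYZ P R ≠ ∞ ∧
    ∀ (q : Measure R.Z) [IsProbabilityMeasure q],
      ibObjective P β R < ibObjective P β (trivialRep 𝒳 q)

/-- The probability `p(Ω)` of the event `X ∈ Ω`. -/
def probX (P : Measure (𝒳 × 𝒴)) (Ω : Set 𝒳) : ℝ :=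
  P.fst.real Ω

/-- The conditional law `p(y|Ω)` of `Y` given the event `X ∈ Ω`. -/
def condY (P : Measure (𝒳 × 𝒴)) (Ω : Set 𝒳) : Measure 𝒴 :=
  (ProbabilityTheory.cond P (Prod.fst ⁻¹' Ω)).snd

/-- The expectation over `y ∼ p(y|Ω)` of `p(y|Ω) / p(y) - 1`. The quotient of the two probabilities
(or densities) is the Radon-Nikodym derivative of the law `p(·|Ω)` with respect to the law of `Y`,
which dominates it. -/
def ratioExpectation (P : Measure (𝒳 × 𝒴)) (Ω : Set 𝒳) : ℝ :=
  ∫ y, (((condY P Ω).rnDeriv P.snd y).toReal - 1) ∂(condY P Ω)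

/-- The quotient `β₀(Ω)`, for `0 < p(Ω) < 1`. Its numerator is then positive, and the quotient is
infinite if the (nonnegative) denominator is zero, i.e. if `p(y|Ω) = p(y)`. -/
def betaZero (P : Measure (𝒳 × 𝒴)) (Ω : Set 𝒳) : ℝ≥0∞ :=
  ENNReal.ofReal (1 / probX P Ω - 1) / ENNReal.ofReal (ratioExpectation P Ω)

/-- The infimum of `β₀(Ω)` over the events `Ω` for which it is defined: the measurable `Ω` with
`0 < p(Ω)` (otherwise `p(y|Ω)` is undefined) and `p(Ω) < 1` (otherwise `β₀(Ω)` is `0 / 0`). -/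
def infBetaZero (P : Measure (𝒳 × 𝒴)) : ℝ≥0∞ :=
  ⨅ (Ω : Set 𝒳) (_ : MeasurableSet Ω) (_ : 0 < probX P Ω) (_ : probX P Ω < 1), betaZero P Ω

/-- The conspicuous subset condition: `X` and `Y` are not independent and `β` exceeds the infimum
of `β₀(Ω)`. -/
def ConspicuousCondition (P : Measure (𝒳 × 𝒴)) (β : ℝ) : Prop :=
  ¬ IndepFun Prod.fst Prod.snd P ∧ infBetaZero P < ENNReal.ofReal β

/-- The Pareto frontier of the information plane: the largest `I(Y;Z)` (as a supremum) among the
representations with `I(X;Z) ≤ r`. -/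
def paretoFrontier (P : Measure (𝒳 × 𝒴)) (r : ℝ≥0∞) : ℝ≥0∞ :=
  ⨆ (R : Representation 𝒳) (_ : infoXZ P R ≤ r), infoYZ P R

/-- The slope of the Pareto frontier at the origin, as the lower limit of its difference quotients
for `r → 0`, `r > 0`; it is the derivative at `0` whenever that derivative exists. (The frontier is
monotone in `r`, so the truncated subtraction is the actual one.) -/
def paretoSlope (P : Measure (𝒳 × 𝒴)) : ℝ≥0∞ :=
  liminf (fun r : ℝ≥0∞ => (paretoFrontier P r - paretoFrontier P 0) / r) (𝓝[>] (0 : ℝ≥0∞))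

/-- The law of `(g(X), Y)` when `(X, Y)` has law `P`. -/
def mapX {𝒳' : Type*} [MeasurableSpace 𝒳'] (g : 𝒳 → 𝒳') (P : Measure (𝒳 × 𝒴)) :
    Measure (𝒳' × 𝒴) :=
  P.map (fun p => (g p.1, p.2))

end IBLearn

end

namespace IBLearn

open InformationTheory

variable {A : Type*} [MeasurableSpace A]

/-! Everything is tested on one noisy bit: given `x`, the sign `±` has probability `(1 ± h(x)) / 2`,
with `h = ε (1_Ω - p)`, `p = p(Ω)`. Given `y` the bit has the same form, `h` being replaced by its
conditional expectation `ε p (f(y) - 1)`, where `f` is the density of `p(y|Ω)` against the law of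
`Y`. Since `klFun (1 + t) = t²/2 + O(|t|³)` (`abs_klFun_one_add_sub_le`), mutual information is half
a second moment to leading order: `I(X;Z) ≈ ε²/2 · p (1 - p)` and `I(Y;Z) ≈ ε²/2 · p² E[f - 1]`, the
expectation being over `p(y|Ω)`. The quotient of the leading terms is `β₀(Ω)`;
`exists_representation` gives this with explicit errors. If `β > β₀(Ω)`, a small `ε` makes the
objective negative, while trivial representations give `0`. If `c < 1/β₀(Ω)`, tuning `ε` to `r`
gives `I(X;Z) ≤ r` and `I(Y;Z) ≥ c r` for all small `r > 0`, which bounds the slope. Invariance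
holds because only the events `X ∈ Ω` matter, and `Ω = g⁻¹(g(Ω))` for injective `g`. -/

theorem abs_klFun_one_add_sub_le {t : ℝ} (ht : |t| ≤ 1 / 2) :
    |klFun (1 + t) - t ^ 2 / 2| ≤ 4 * |t| * t ^ 2 := by
  -- The remainder `e` of `log (1 + t)` after two terms is at most `|t|³ / (1 - |t|) ≤ 2|t|³`. The
  -- total error is then at most `(1/2 + 3)|t|³`, whence the constant 4.
  have h1 := Real.abs_log_sub_add_sum_range_le (x := -t) (by rw [abs_neg]; linarith) 2
  simp only [Finset.sum_range_succ, Finset.sum_range_zero, abs_neg, sub_neg_eq_add] at h1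
  norm_num at h1
  set e := -t + t ^ 2 / 2 + Real.log (1 + t) with he
  have h2 : |e| ≤ 2 * |t| ^ 3 := by
    refine h1.trans ?_
    rw [div_le_iff₀ (by linarith)]
    nlinarith [pow_nonneg (abs_nonneg t) 3]
  have h3 : klFun (1 + t) - t ^ 2 / 2 = -t ^ 3 / 2 + (1 + t) * e := by
    rw [klFun_apply, he]; ring
  have h4 : |1 + t| ≤ 3 / 2 := by
    refine (abs_add_le _ _).trans ?_
    rw [abs_one]; linarith
  have h5 : |(1 + t) * e| ≤ 3 / 2 * (2 * |t| ^ 3) := by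
    rw [abs_mul]; gcongr
  have h6 : |-t ^ 3 / 2| = |t| ^ 3 / 2 := by
    rw [abs_div, abs_neg, abs_pow]; norm_num
  rw [h3, ← sq_abs t]
  refine (abs_add_le _ _).trans ?_
  rw [h6]
  nlinarith [pow_nonneg (abs_nonneg t) 3]

/-! ### Mutual information of a weakly biased bit -/

/-- The law of a fair coin. -/
noncomputable def coin : Measure Bool :=
  (2⁻¹ : ℝ≥0∞) • Measure.dirac true + (2⁻¹ : ℝ≥0∞) • Measure.dirac false

instance : IsProbabilityMeasure coin :=
  ⟨by simp [coin, ENNReal.inv_two_add_inv_two]⟩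

/-- The sign `±1` encoded by a bit. -/
noncomputable def bitSign (b : Bool) : ℝ := if b then 1 else -1

theorem abs_bitSign (b : Bool) : |bitSign b| = 1 := by cases b <;> simp [bitSign]

theorem bitSign_sq (b : Bool) : bitSign b ^ 2 = 1 := by rw [← sq_abs, abs_bitSign, one_pow]

/-- The random bit with conditional density `1 ± h` with respect to a fair coin. -/
noncomputable def bitKernel (h : A → ℝ) : Kernel A Bool :=
  Kernel.withDensity (Kernel.const A coin) fun a b => ENNReal.ofReal (1 + bitSign b * h a)

theorem measurable_bitDensity {h : A → ℝ} (hh : Measurable h) :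
    Measurable (Function.uncurry fun a b => ENNReal.ofReal (1 + bitSign b * h a)) :=
  ((((measurable_of_countable bitSign).comp measurable_snd).mul
    (hh.comp measurable_fst)).const_add 1).ennreal_ofReal

theorem one_add_bitSign_mul_nonneg {A : Type*} {h : A → ℝ} (hb : ∀ a, |h a| ≤ 1) (a : A) (b : Bool) :
    0 ≤ 1 + bitSign b * h a := by
  have h1 : |bitSign b * h a| ≤ 1 := by rw [abs_mul, abs_bitSign, one_mul]; exact hb a
  linarith [neg_abs_le (bitSign b * h a)]

theorem bitKernel_singleton {h : A → ℝ} (hh : Measurable h) (a : A) (b : Bool) :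
    bitKernel h a {b} = 2⁻¹ * ENNReal.ofReal (1 + bitSign b * h a) := by
  rw [bitKernel, Kernel.withDensity_apply' _ (measurable_bitDensity hh), Kernel.const_apply,
    lintegral_singleton, mul_comm]
  cases b <;> simp [coin]

theorem isMarkovKernel_bitKernel {h : A → ℝ} (hh : Measurable h) (hb : ∀ a, |h a| ≤ 1) :
    IsMarkovKernel (bitKernel h) := by
  refine ⟨fun a => ⟨?_⟩⟩
  have hu : (Set.univ : Set Bool) = {true} ∪ {false} := by ext b; cases b <;> simp
  rw [hu, measure_union (by simp) (measurableSet_singleton _), bitKernel_singleton hh,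
    bitKernel_singleton hh, ← mul_add, ← ENNReal.ofReal_add (one_add_bitSign_mul_nonneg hb a _)
      (one_add_bitSign_mul_nonneg hb a _)]
  have : 1 + bitSign true * h a + (1 + bitSign false * h a) = 2 := by simp [bitSign]; ring
  rw [this, ENNReal.ofReal_ofNat, ENNReal.inv_mul_cancel (by simp) (by simp)]

theorem compProd_bitKernel {μ : Measure A} [IsProbabilityMeasure μ] {h : A → ℝ}
    (hh : Measurable h) (hb : ∀ a, |h a| ≤ 1) :
    μ ⊗ₘ bitKernel h =
      (μ.prod coin).withDensity fun p => ENNReal.ofReal (1 + bitSign p.2 * h p.1) := by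
  have := isMarkovKernel_bitKernel hh hb
  unfold bitKernel at this ⊢
  rw [Measure.compProd_withDensity (measurable_bitDensity hh), Measure.compProd_const]

theorem compProd_bitKernel_prod_singleton {μ : Measure A} [IsProbabilityMeasure μ] {h : A → ℝ}
    (hh : Measurable h) (hb : ∀ a, |h a| ≤ 1) {s : Set A} (hs : MeasurableSet s) (b : Bool) :
    (μ ⊗ₘ bitKernel h) (s ×ˢ {b}) =
      2⁻¹ * ENNReal.ofReal (μ.real s + bitSign b * ∫ a in s, h a ∂μ) := by
  have := isMarkovKernel_bitKernel hh hb
  have hint : Integrable h μ :=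
    Integrable.of_bound hh.aestronglyMeasurable 1 (ae_of_all _ hb)
  rw [Measure.compProd_apply_prod hs (measurableSet_singleton b)]
  simp_rw [bitKernel_singleton hh]
  rw [lintegral_const_mul _ ((measurable_bitDensity hh).of_uncurry_right),
    ← ofReal_integral_eq_lintegral_ofReal (f := fun a => 1 + bitSign b * h a)
      ((integrable_const _).add ((hint.integrableOn).const_mul _))
      (ae_of_all _ fun a => one_add_bitSign_mul_nonneg hb a b),
    integral_add (integrable_const _) ((hint.integrableOn).const_mul _), integral_const_mul]
  simp

theorem ext_of_prod_singleton {μ ν : Measure (A × Bool)}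
    (h : ∀ s, MeasurableSet s → ∀ b, μ (s ×ˢ {b}) = ν (s ×ˢ {b})) : μ = ν := by
  ext t ht
  have hm : ∀ b, MeasurableSet ((fun a : A => (a, b)) ⁻¹' t) := fun b =>
    measurable_prodMk_right ht
  have ht' : t = ⋃ b, ((fun a : A => (a, b)) ⁻¹' t) ×ˢ {b} := by
    ext ⟨a, b⟩
    simp
  have hd : Pairwise (Function.onFun Disjoint
      fun b => ((fun a : A => (a, b)) ⁻¹' t) ×ˢ ({b} : Set Bool)) := fun b c hbc =>
    Set.disjoint_prod.2 (Or.inr (by simpa using hbc))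
  rw [ht', measure_iUnion hd fun b => (hm b).prod (measurableSet_singleton b),
    measure_iUnion hd fun b => (hm b).prod (measurableSet_singleton b)]
  exact tsum_congr fun b => h _ (hm b) b

theorem snd_compProd_bitKernel {μ : Measure A} [IsProbabilityMeasure μ] {h : A → ℝ}
    (hh : Measurable h) (hb : ∀ a, |h a| ≤ 1) (h0 : ∫ a, h a ∂μ = 0) :
    (μ ⊗ₘ bitKernel h).snd = coin := by
  refine Measure.ext_of_singleton fun b => ?_
  have := compProd_bitKernel_prod_singleton (μ := μ) hh hb MeasurableSet.univ b
  rw [Measure.snd_apply (measurableSet_singleton b), ← Set.univ_prod, this]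
  cases b <;> simp [coin, h0]

/-- As `h` has mean zero, the bit is marginally a fair coin, so the product of the marginals is
`μ.prod coin`, against which the joint law has density `1 ± h`. -/
theorem mutualInfo_bitKernel {μ : Measure A} [IsProbabilityMeasure μ] {h : A → ℝ}
    (hh : Measurable h) (hb : ∀ a, |h a| ≤ 1) (h0 : ∫ a, h a ∂μ = 0) :
    mutualInfo (μ ⊗ₘ bitKernel h) =
      ∫⁻ p, ENNReal.ofReal (klFun (1 + bitSign p.2 * h p.1)) ∂(μ.prod coin) := by
  have := isMarkovKernel_bitKernel hh hb
  have hm : Measurable fun p : A × Bool => ENNReal.ofReal (1 + bitSign p.2 * h p.1) :=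
    measurable_bitDensity hh
  rw [mutualInfo, snd_compProd_bitKernel hh hb h0, Measure.fst_compProd,
    klDiv_eq_lintegral_klFun_of_ac]
  · refine lintegral_congr_ae ?_
    rw [compProd_bitKernel hh hb]
    filter_upwards [Measure.rnDeriv_withDensity (μ.prod coin) hm] with p hp
    rw [hp, ENNReal.toReal_ofReal (one_add_bitSign_mul_nonneg hb _ _)]
  · rw [compProd_bitKernel hh hb]
    exact withDensity_absolutelyContinuous _ _

theorem lintegral_ofReal_sq_prod_coin {μ : Measure A} [IsProbabilityMeasure μ] {h : A → ℝ}
    (hh : Measurable h) (hb : ∀ a, |h a| ≤ 1) {c : ℝ} (hc : 0 ≤ c) :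
    ∫⁻ p, ENNReal.ofReal (c * h p.1 ^ 2) ∂(μ.prod coin) =
      ENNReal.ofReal (c * ∫ a, h a ^ 2 ∂μ) := by
  have hm : Measurable fun p : A × Bool => ENNReal.ofReal (c * h p.1 ^ 2) := by fun_prop
  have hint : Integrable (fun a => h a ^ 2) μ := by
    refine Integrable.of_bound (hh.pow_const 2).aestronglyMeasurable 1 (ae_of_all _ fun a => ?_)
    rw [Real.norm_eq_abs, abs_pow]
    exact pow_le_one₀ (abs_nonneg _) (hb a)
  rw [lintegral_prod _ hm.aemeasurable]
  simp only [lintegral_const, measure_univ, mul_one]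
  rw [← integral_const_mul, ofReal_integral_eq_lintegral_ofReal (hint.const_mul c)
    (ae_of_all _ fun a => by positivity)]

theorem mutualInfo_bitKernel_le {μ : Measure A} [IsProbabilityMeasure μ] {h : A → ℝ} {ε : ℝ}
    (hh : Measurable h) (hε : 0 ≤ ε) (hε' : ε ≤ 1 / 2) (hb : ∀ a, |h a| ≤ ε)
    (h0 : ∫ a, h a ∂μ = 0) :
    mutualInfo (μ ⊗ₘ bitKernel h) ≤ ENNReal.ofReal ((1 / 2 + 4 * ε) * ∫ a, h a ^ 2 ∂μ) := by
  have hb1 : ∀ a, |h a| ≤ 1 := fun a => (hb a).trans (by linarith)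
  rw [mutualInfo_bitKernel hh hb1 h0,
    ← lintegral_ofReal_sq_prod_coin hh hb1 (by positivity)]
  refine lintegral_mono fun p => ENNReal.ofReal_le_ofReal ?_
  have ht : |bitSign p.2 * h p.1| = |h p.1| := by rw [abs_mul, abs_bitSign, one_mul]
  have h1 := abs_klFun_one_add_sub_le (t := bitSign p.2 * h p.1)
    (by rw [ht]; exact (hb _).trans hε')
  rw [ht, mul_pow, bitSign_sq, one_mul] at h1
  nlinarith [(abs_le.1 h1).2, mul_le_mul_of_nonneg_right (hb p.1) (sq_nonneg (h p.1))]

theorem le_mutualInfo_bitKernel {μ : Measure A} [IsProbabilityMeasure μ] {h : A → ℝ} {ε : ℝ}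
    (hh : Measurable h) (hε' : ε ≤ 1 / 8) (hb : ∀ a, |h a| ≤ ε)
    (h0 : ∫ a, h a ∂μ = 0) :
    ENNReal.ofReal ((1 / 2 - 4 * ε) * ∫ a, h a ^ 2 ∂μ) ≤ mutualInfo (μ ⊗ₘ bitKernel h) := by
  have hb1 : ∀ a, |h a| ≤ 1 := fun a => (hb a).trans (by linarith)
  rw [mutualInfo_bitKernel hh hb1 h0,
    -- The bound `ε ≤ 1/8` serves here: the coefficient `1/2 - 4ε` must be nonnegative.
    ← lintegral_ofReal_sq_prod_coin hh hb1 (by linarith)]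
  refine lintegral_mono fun p => ENNReal.ofReal_le_ofReal ?_
  have ht : |bitSign p.2 * h p.1| = |h p.1| := by rw [abs_mul, abs_bitSign, one_mul]
  have h1 := abs_klFun_one_add_sub_le (t := bitSign p.2 * h p.1)
    (by rw [ht]; exact (hb _).trans (by linarith))
  rw [ht, mul_pow, bitSign_sq, one_mul] at h1
  nlinarith [(abs_le.1 h1).1, mul_le_mul_of_nonneg_right (hb p.1) (sq_nonneg (h p.1))]

/-! ### Joint laws, trivial representations and one-bit representations -/

variable {𝒳 𝒴 : Type*} [MeasurableSpace 𝒳] [MeasurableSpace 𝒴]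

theorem map_fst_jointLaw (P : Measure (𝒳 × 𝒴)) [IsProbabilityMeasure P] (R : Representation 𝒳) :
    (jointLaw P R).map (fun w => (w.1.1, w.2)) = P.fst ⊗ₘ R.encoder := by
  ext s hs
  have hm : Measurable fun w : (𝒳 × 𝒴) × R.Z => (w.1.1, w.2) := by fun_prop
  rw [Measure.map_apply hm hs, jointLaw, Measure.compProd_apply (hm hs), Measure.compProd_apply hs,
    Measure.fst, lintegral_map (Kernel.measurable_kernel_prodMk_left hs) measurable_fst]
  rfl

theorem jointLaw_map_snd_apply_prod (P : Measure (𝒳 × 𝒴)) [IsProbabilityMeasure P]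
    (R : Representation 𝒳) {s : Set 𝒴} (hs : MeasurableSet s) {t : Set R.Z}
    (ht : MeasurableSet t) :
    (jointLaw P R).map (fun w => (w.1.2, w.2)) (s ×ˢ t) =
      ∫⁻ p in Prod.snd ⁻¹' s, R.encoder p.1 t ∂P := by
  have hm : Measurable fun w : (𝒳 × 𝒴) × R.Z => (w.1.2, w.2) := by fun_prop
  have he : (fun w : (𝒳 × 𝒴) × R.Z => (w.1.2, w.2)) ⁻¹' (s ×ˢ t) = (Prod.snd ⁻¹' s) ×ˢ t := by
    ext; simp
  rw [Measure.map_apply hm (hs.prod ht), he, jointLaw,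
    Measure.compProd_apply_prod (measurable_snd hs) ht]
  rfl

/-- Vanishing divergence makes the encoder almost surely constant, so `Z` is independent of `Y` too.
This yields both the zero objective of trivial representations and `F(0) = 0`. -/
theorem infoYZ_eq_zero (P : Measure (𝒳 × 𝒴)) [IsProbabilityMeasure P] (R : Representation 𝒳)
    (h : infoXZ P R = 0) : infoYZ P R = 0 := by
  rw [infoXZ, mutualInfo, map_fst_jointLaw, klDiv_eq_zero_iff, Measure.fst_compProd,
    ← Measure.compProd_const, Kernel.compProd_eq_iff] at h
  set ν := (P.fst ⊗ₘ R.encoder).snd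
  have hP : ∀ᵐ p ∂P, R.encoder p.1 = ν := ae_of_ae_map measurable_fst.aemeasurable h
  have hj : (jointLaw P R).map (fun w => (w.1.2, w.2)) = P.snd.prod ν := by
    have : IsFiniteMeasure ((jointLaw P R).map fun w => (w.1.2, w.2)) := by
      unfold jointLaw
      infer_instance
    refine Measure.ext_prod fun {s t} hs ht => ?_
    rw [jointLaw_map_snd_apply_prod P R hs ht, Measure.prod_prod, Measure.snd_apply hs,
      lintegral_congr_ae (g := fun _ => ν t)
        (ae_restrict_of_ae (hP.mono fun p hp => by rw [hp]))]
    simp [mul_comm]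
  have hs : (P.snd.prod ν).snd = ν := by simp
  have hf : (P.snd.prod ν).fst = P.snd := by simp
  rw [infoYZ, mutualInfo, hj, hs, hf, klDiv_self]

theorem infoXZ_trivialRep (P : Measure (𝒳 × 𝒴)) [IsProbabilityMeasure P] {Z : Type}
    [MeasurableSpace Z] [StandardBorelSpace Z] (q : Measure Z) [IsProbabilityMeasure q] :
    infoXZ P (trivialRep 𝒳 q) = 0 := by
  rw [infoXZ, mutualInfo, map_fst_jointLaw]
  change klDiv (P.fst ⊗ₘ Kernel.const 𝒳 q) ((P.fst ⊗ₘ Kernel.const 𝒳 q).fst.prod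
    (P.fst ⊗ₘ Kernel.const 𝒳 q).snd) = 0
  rw [Measure.compProd_const]
  simp

theorem ibObjective_trivialRep (P : Measure (𝒳 × 𝒴)) [IsProbabilityMeasure P] (β : ℝ) {Z : Type}
    [MeasurableSpace Z] [StandardBorelSpace Z] (q : Measure Z) [IsProbabilityMeasure q] :
    ibObjective P β (trivialRep 𝒳 q) = 0 := by
  have h := infoXZ_trivialRep P q
  rw [ibObjective, h, infoYZ_eq_zero P _ h]
  simp

theorem paretoFrontier_zero (P : Measure (𝒳 × 𝒴)) [IsProbabilityMeasure P] :
    paretoFrontier P 0 = 0 := by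
  simp only [paretoFrontier, nonpos_iff_eq_zero, ENNReal.iSup_eq_zero]
  exact fun R hR => infoYZ_eq_zero P R hR

/-- The representation by a bit with conditional density `1 ± h(x)`. -/
noncomputable def bitRep (h : 𝒳 → ℝ) (hh : Measurable h) (hb : ∀ x, |h x| ≤ 1) :
    Representation 𝒳 where
  Z := Bool
  encoder := bitKernel h
  markov := isMarkovKernel_bitKernel hh hb

theorem infoXZ_bitRep (P : Measure (𝒳 × 𝒴)) [IsProbabilityMeasure P] {h : 𝒳 → ℝ}
    (hh : Measurable h) (hb : ∀ x, |h x| ≤ 1) :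
    infoXZ P (bitRep h hh hb) = mutualInfo (P.fst ⊗ₘ bitKernel h) := by
  rw [infoXZ, map_fst_jointLaw]
  rfl

/-- The hypothesis `hhk` says that `k(Y)` is the conditional expectation of `h(X)` given `Y`. The
law of the bit is affine in `h`, so averaging over `X` just replaces `h` by `k`; no conditional law
of `X` given `Y` is needed. -/
theorem infoYZ_bitRep (P : Measure (𝒳 × 𝒴)) [IsProbabilityMeasure P] {h : 𝒳 → ℝ}
    (hh : Measurable h) (hb : ∀ x, |h x| ≤ 1) {k : 𝒴 → ℝ} (hk : Measurable k)
    (hkb : ∀ y, |k y| ≤ 1)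
    (hhk : ∀ s, MeasurableSet s → ∫ p in Prod.snd ⁻¹' s, h p.1 ∂P = ∫ y in s, k y ∂P.snd) :
    infoYZ P (bitRep h hh hb) = mutualInfo (P.snd ⊗ₘ bitKernel k) := by
  have := isMarkovKernel_bitKernel (hh.comp measurable_fst) fun p : 𝒳 × 𝒴 => hb p.1
  rw [infoYZ]
  congr 1
  refine ext_of_prod_singleton fun s hs b => ?_
  have h1 := compProd_bitKernel_prod_singleton (μ := P) (hh.comp measurable_fst)
    (fun p => hb p.1) (measurable_snd hs) b
  rw [Measure.compProd_apply_prod (measurable_snd hs) (measurableSet_singleton b)] at h1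
  rw [compProd_bitKernel_prod_singleton hk hkb hs b, ← hhk s hs]
  refine (jointLaw_map_snd_apply_prod P (bitRep h hh hb) hs (measurableSet_singleton b)).trans ?_
  have h2 : P.snd.real s = P.real (Prod.snd ⁻¹' s) := by
    rw [measureReal_def, Measure.snd_apply hs, measureReal_def]
  rw [h2]
  refine Eq.trans ?_ h1
  refine lintegral_congr fun p => ?_
  rw [bitKernel_singleton (hh.comp measurable_fst)]
  exact bitKernel_singleton hh p.1 b

theorem abs_indicator_sub_le {α : Type*} {Ω : Set α} {c : ℝ} (h0 : 0 ≤ c) (h1 : c ≤ 1) (x : α) :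
    |Ω.indicator (1 : α → ℝ) x - c| ≤ 1 := by
  by_cases hx : x ∈ Ω <;> simp [hx, abs_le] <;> constructor <;> linarith

/-! ### The conditional deviation of an event and its second moment -/

section Conditional

variable (P : Measure (𝒳 × 𝒴)) {Ω : Set 𝒳}

theorem probX_eq (hΩ : MeasurableSet Ω) : probX P Ω = P.real (Prod.fst ⁻¹' Ω) := by
  rw [probX, measureReal_def, Measure.fst_apply hΩ, measureReal_def]

theorem condY_apply (hΩ : MeasurableSet Ω) {s : Set 𝒴} (hs : MeasurableSet s) :
    condY P Ω s = (P (Prod.fst ⁻¹' Ω))⁻¹ * P (Prod.fst ⁻¹' Ω ∩ Prod.snd ⁻¹' s) := by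
  rw [condY, Measure.snd_apply hs, cond_apply (measurable_fst hΩ)]

/-- The conditional expectation of `1_Ω(X) - p(Ω)` given `Y = y`. -/
noncomputable def condDev (P : Measure (𝒳 × 𝒴)) (Ω : Set 𝒳) (y : 𝒴) : ℝ :=
  probX P Ω * (min ((condY P Ω).rnDeriv P.snd y).toReal (probX P Ω)⁻¹ - 1)

theorem measurable_condDev : Measurable (condDev P Ω) :=
  (((Measure.measurable_rnDeriv _ _).ennreal_toReal.min measurable_const).sub_const 1).const_mul _

/-- The truncation in `condDev` makes this bound hold everywhere, as a Markov kernel requires, and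
not just almost everywhere. -/
theorem abs_condDev_le (h0 : 0 < probX P Ω) (h1 : probX P Ω < 1) (y : 𝒴) :
    |condDev P Ω y| ≤ 1 := by
  rw [abs_le, condDev]
  have h2 : 0 ≤ min ((condY P Ω).rnDeriv P.snd y).toReal (probX P Ω)⁻¹ :=
    le_min ENNReal.toReal_nonneg (by positivity)
  have h3 := mul_le_mul_of_nonneg_left
    (min_le_right ((condY P Ω).rnDeriv P.snd y).toReal (probX P Ω)⁻¹) h0.le
  rw [mul_inv_cancel₀ h0.ne'] at h3
  constructor <;> nlinarith

theorem smul_condY_le (hΩ : MeasurableSet Ω) : P (Prod.fst ⁻¹' Ω) • condY P Ω ≤ P.snd := by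
  refine Measure.le_iff.2 fun s hs => ?_
  rw [Measure.smul_apply, condY_apply P hΩ hs, Measure.snd_apply hs, smul_eq_mul, ← mul_assoc]
  refine (mul_le_mul' (ENNReal.mul_inv_le_one _) le_rfl).trans ?_
  rw [one_mul]
  exact measure_mono Set.inter_subset_right

theorem condY_absolutelyContinuous (hΩ : MeasurableSet Ω) : condY P Ω ≪ P.snd := by
  refine Measure.AbsolutelyContinuous.mk fun s hs h => ?_
  rw [Measure.snd_apply hs] at h
  rw [condY_apply P hΩ hs, measure_mono_null Set.inter_subset_right h, mul_zero]

variable [IsProbabilityMeasure P]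

theorem isProbabilityMeasure_condY (hΩ : MeasurableSet Ω) (h0 : 0 < probX P Ω) :
    IsProbabilityMeasure (condY P Ω) := by
  have hne : P (Prod.fst ⁻¹' Ω) ≠ 0 := fun h => by simp [probX_eq P hΩ, measureReal_def, h] at h0
  have : IsProbabilityMeasure (P[|Prod.fst ⁻¹' Ω]) := cond_isProbabilityMeasure hne
  unfold condY
  infer_instance

/-- Since `p(Ω) p(·|Ω)` is dominated by the law of `Y`, the truncation in `condDev` changes nothing
almost everywhere. -/
theorem toReal_rnDeriv_condY_le (hΩ : MeasurableSet Ω) (h0 : 0 < probX P Ω) :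
    ∀ᵐ y ∂P.snd, ((condY P Ω).rnDeriv P.snd y).toReal ≤ (probX P Ω)⁻¹ := by
  have hp := probX_eq P hΩ
  have := isProbabilityMeasure_condY P hΩ h0
  filter_upwards [Measure.rnDeriv_le_one_of_le (smul_condY_le P hΩ),
    Measure.rnDeriv_smul_left_of_ne_top (condY P Ω) P.snd (measure_ne_top P (Prod.fst ⁻¹' Ω))]
    with y h1 h2
  rw [h2, Pi.smul_apply, smul_eq_mul, Pi.one_apply] at h1
  have h3 := ENNReal.toReal_mono ENNReal.one_ne_top h1
  rw [ENNReal.toReal_mul, ENNReal.toReal_one, ← measureReal_def, ← hp] at h3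
  rwa [inv_eq_one_div, le_div_iff₀ h0, mul_comm]

theorem condDev_ae_eq (hΩ : MeasurableSet Ω) (h0 : 0 < probX P Ω) :
    condDev P Ω =ᵐ[P.snd] fun y =>
      probX P Ω * (((condY P Ω).rnDeriv P.snd y).toReal - 1) := by
  filter_upwards [toReal_rnDeriv_condY_le P hΩ h0] with y hy
  rw [condDev, min_eq_left hy]

/-- Both sides equal `P(X ∈ Ω, Y ∈ s) - p(Ω) P(Y ∈ s)`. This is the hypothesis `hhk` of
`infoYZ_bitRep`, up to the factor `ε`. -/
theorem setIntegral_condDev (hΩ : MeasurableSet Ω) (h0 : 0 < probX P Ω) {s : Set 𝒴}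
    (hs : MeasurableSet s) :
    ∫ p in Prod.snd ⁻¹' s, (Ω.indicator 1 p.1 - probX P Ω) ∂P = ∫ y in s, condDev P Ω y ∂P.snd := by
  have := isProbabilityMeasure_condY P hΩ h0
  have hi : (fun p : 𝒳 × 𝒴 => Ω.indicator (1 : 𝒳 → ℝ) p.1) = (Prod.fst ⁻¹' Ω).indicator 1 := rfl
  rw [integral_congr_ae (ae_restrict_of_ae (condDev_ae_eq P hΩ h0)), integral_const_mul,
    integral_sub Measure.integrable_toReal_rnDeriv.integrableOn (integrable_const _),
    Measure.setIntegral_toReal_rnDeriv (condY_absolutelyContinuous P hΩ),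
    integral_sub _ (integrable_const _), hi, integral_indicator_one (measurable_fst hΩ)]
  · simp only [integral_const, measureReal_restrict_apply_univ,
      measureReal_restrict_apply (measurable_fst hΩ), smul_eq_mul, mul_one]
    rw [mul_sub]
    simp only [measureReal_def, condY_apply P hΩ hs, Measure.snd_apply hs, ENNReal.toReal_mul,
      ENNReal.toReal_inv]
    simp only [← measureReal_def, ← probX_eq P hΩ]
    field_simp
  · rw [hi]
    exact ((integrable_const (1 : ℝ)).indicator (measurable_fst hΩ))

/-- Write `(f - 1)² = f (f - 1) - (f - 1)`: the last term has mean zero, and the factor `f` turns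
the law of `Y` into `p(y|Ω)`. -/
theorem integral_condDev_sq (hΩ : MeasurableSet Ω) (h0 : 0 < probX P Ω) :
    ∫ y, condDev P Ω y ^ 2 ∂P.snd = probX P Ω ^ 2 * ratioExpectation P Ω := by
  have := isProbabilityMeasure_condY P hΩ h0
  have hac := condY_absolutelyContinuous P hΩ
  have hint : Integrable (fun y => ((condY P Ω).rnDeriv P.snd y).toReal) P.snd :=
    Measure.integrable_toReal_rnDeriv
  have hint2 : Integrable (fun y => ((condY P Ω).rnDeriv P.snd y).toReal *
      (((condY P Ω).rnDeriv P.snd y).toReal - 1)) P.snd := by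
    refine (hint.sub (integrable_const 1)).bdd_mul (c := (probX P Ω)⁻¹)
      hint.aestronglyMeasurable ?_
    filter_upwards [toReal_rnDeriv_condY_le P hΩ h0] with y hy
    rwa [Real.norm_eq_abs, abs_of_nonneg ENNReal.toReal_nonneg]
  have hz : ∫ y, (((condY P Ω).rnDeriv P.snd y).toReal - 1) ∂P.snd = 0 := by
    rw [integral_sub hint (integrable_const _), Measure.integral_toReal_rnDeriv hac]
    simp
  rw [ratioExpectation, ← integral_toReal_rnDeriv_mul hac, ← sub_zero (∫ y, _ * _ ∂_), ← hz,
    ← integral_sub hint2 (by exact hint.sub (integrable_const 1)), ← integral_const_mul]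
  refine integral_congr_ae ?_
  filter_upwards [condDev_ae_eq P hΩ h0] with y hy
  rw [hy]
  ring

theorem measurable_indicator_sub (hΩ : MeasurableSet Ω) (c : ℝ) :
    Measurable fun x => Ω.indicator (1 : 𝒳 → ℝ) x - c :=
  (measurable_one.indicator hΩ).sub_const c

theorem integrable_indicator_one (hΩ : MeasurableSet Ω) :
    Integrable (Ω.indicator (1 : 𝒳 → ℝ)) P.fst :=
  (integrable_const (1 : ℝ)).indicator hΩ

theorem integral_indicator_sub (hΩ : MeasurableSet Ω) :
    ∫ x, (Ω.indicator (1 : 𝒳 → ℝ) x - probX P Ω) ∂P.fst = 0 := by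
  rw [integral_sub (integrable_indicator_one P hΩ) (integrable_const _),
    integral_indicator_one hΩ]
  simp [probX]

theorem integral_indicator_sub_sq (hΩ : MeasurableSet Ω) :
    ∫ x, (Ω.indicator (1 : 𝒳 → ℝ) x - probX P Ω) ^ 2 ∂P.fst = probX P Ω * (1 - probX P Ω) := by
  have h : ∀ x, (Ω.indicator (1 : 𝒳 → ℝ) x - probX P Ω) ^ 2 =
      (1 - 2 * probX P Ω) * Ω.indicator (1 : 𝒳 → ℝ) x + probX P Ω ^ 2 := fun x => by
    by_cases hx : x ∈ Ω <;> simp [hx]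
    ring
  simp_rw [h]
  rw [integral_add ((integrable_indicator_one P hΩ).const_mul _) (integrable_const _),
    integral_const_mul, integral_indicator_one hΩ]
  simp only [integral_const, probReal_univ, smul_eq_mul, one_mul]
  rw [← probX]
  ring

/-- The bit with `h = ε (1_Ω - p(Ω))`. The upper bound on `I(Y;Z)` serves only to show that it is
finite. -/
theorem exists_representation (hΩ : MeasurableSet Ω) (h0 : 0 < probX P Ω) (h1 : probX P Ω < 1)
    {ε : ℝ} (hε : 0 ≤ ε) (hε' : ε ≤ 1 / 8) :
    ∃ R : Representation 𝒳,
      infoXZ P R ≤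
        ENNReal.ofReal ((1 / 2 + 4 * ε) * (ε ^ 2 * (probX P Ω * (1 - probX P Ω)))) ∧
      infoYZ P R ≤
        ENNReal.ofReal ((1 / 2 + 4 * ε) * (ε ^ 2 * (probX P Ω ^ 2 * ratioExpectation P Ω))) ∧
      ENNReal.ofReal ((1 / 2 - 4 * ε) * (ε ^ 2 * (probX P Ω ^ 2 * ratioExpectation P Ω))) ≤
        infoYZ P R := by
  have hm := (measurable_indicator_sub hΩ (probX P Ω)).const_mul ε
  have hb : ∀ x, |ε * (Ω.indicator (1 : 𝒳 → ℝ) x - probX P Ω)| ≤ ε := fun x => by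
    rw [abs_mul, abs_of_nonneg hε]
    exact mul_le_of_le_one_right hε (abs_indicator_sub_le h0.le h1.le x)
  have hkm := (measurable_condDev P (Ω := Ω)).const_mul ε
  have hkb : ∀ y, |ε * condDev P Ω y| ≤ ε := fun y => by
    rw [abs_mul, abs_of_nonneg hε]
    exact mul_le_of_le_one_right hε (abs_condDev_le P h0 h1 y)
  have hk0 : ∫ y, ε * condDev P Ω y ∂P.snd = 0 := by
    have h := setIntegral_condDev P hΩ h0 MeasurableSet.univ
    rw [Set.preimage_univ, Measure.restrict_univ, Measure.restrict_univ] at h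
    rw [integral_const_mul, ← h]
    have h2 := integral_indicator_sub P hΩ
    rw [Measure.fst, integral_map measurable_fst.aemeasurable
      (measurable_indicator_sub hΩ _).aestronglyMeasurable] at h2
    rw [h2, mul_zero]
  have hle : ε ≤ 1 := by linarith
  have hX := infoXZ_bitRep P hm fun x => (hb x).trans hle
  have hY := infoYZ_bitRep P hm (fun x => (hb x).trans hle) hkm (fun y => (hkb y).trans hle)
    fun s hs => by rw [integral_const_mul, integral_const_mul, setIntegral_condDev P hΩ h0 hs]
  refine ⟨bitRep _ hm fun x => (hb x).trans hle, ?_, ?_, ?_⟩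
  · rw [hX, ← integral_indicator_sub_sq P hΩ, ← integral_const_mul]
    simp_rw [← mul_pow]
    exact mutualInfo_bitKernel_le hm hε (by linarith) hb
      (by rw [integral_const_mul, integral_indicator_sub P hΩ, mul_zero])
  · rw [hY, ← integral_condDev_sq P hΩ h0, ← integral_const_mul]
    simp_rw [← mul_pow]
    exact mutualInfo_bitKernel_le hkm hε (by linarith) hkb hk0
  · rw [hY, ← integral_condDev_sq P hΩ h0, ← integral_const_mul]
    simp_rw [← mul_pow]
    exact le_mutualInfo_bitKernel hkm hε' hkb hk0

end Conditional

/-! ### Learnability and the slope of the Pareto frontier -/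

theorem exists_half_add_mul_lt {a b : ℝ} (ha : 0 ≤ a) (hab : a < b) :
    ∃ ε : ℝ, 0 < ε ∧ ε ≤ 1 / 16 ∧ (1 / 2 + 4 * ε) * a < (1 / 2 - 4 * ε) * b := by
  have hs : 0 < a + b := by linarith
  -- The inequality amounts to `ε < (b - a) / (8 (a + b))`; half of this threshold is taken.
  refine ⟨(b - a) / (16 * (a + b)), by apply div_pos <;> linarith, ?_, ?_⟩
  · rw [div_le_iff₀ (by positivity)]
    linarith
  · have h : (b - a) / (16 * (a + b)) * (a + b) = (b - a) / 16 := by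
      field_simp
    linarith

theorem learnable_of_betaZero_lt (P : Measure (𝒳 × 𝒴)) [IsProbabilityMeasure P] {Ω : Set 𝒳}
    (hΩ : MeasurableSet Ω) (h0 : 0 < probX P Ω) (h1 : probX P Ω < 1) {β : ℝ}
    (hβ : betaZero P Ω < ENNReal.ofReal β) : Learnable P β := by
  have hV : 0 < probX P Ω * (1 - probX P Ω) := mul_pos h0 (by linarith)
  have hD : 0 < ratioExpectation P Ω := by
    by_contra! hD
    rw [betaZero, ENNReal.ofReal_of_nonpos hD, ENNReal.div_zero] at hβ
    · exact not_top_lt hβ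
    · simp only [ne_eq, ENNReal.ofReal_eq_zero, not_le, sub_pos]
      exact (one_lt_div h0).2 h1
  have hβ0 : 0 < β := ENNReal.ofReal_pos.1 (bot_le.trans_lt hβ)
  rw [betaZero, ← ENNReal.ofReal_div_of_pos hD, ENNReal.ofReal_lt_ofReal_iff hβ0,
    div_lt_iff₀ hD, sub_lt_iff_lt_add, div_lt_iff₀ h0] at hβ
  have hVW : probX P Ω * (1 - probX P Ω) <
      β * (probX P Ω ^ 2 * ratioExpectation P Ω) := by nlinarith
  obtain ⟨ε, hε, hε', hlt⟩ := exists_half_add_mul_lt hV.le hVW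
  obtain ⟨R, hX, hY, hY'⟩ := exists_representation P hΩ h0 h1 hε.le (by linarith : ε ≤ 1 / 8)
  have hX1 : infoXZ P R ≠ ∞ := (hX.trans_lt ENNReal.ofReal_lt_top).ne
  have hY1 : infoYZ P R ≠ ∞ := (hY.trans_lt ENNReal.ofReal_lt_top).ne
  refine ⟨R, hX1, hY1, fun q _ => ?_⟩
  rw [ibObjective_trivialRep, ibObjective, sub_neg]
  have h2 := ENNReal.toReal_le_of_le_ofReal (by positivity) hX
  have h3 := (ENNReal.ofReal_le_iff_le_toReal hY1).1 hY'
  have h4 := mul_le_mul_of_nonneg_left h3 hβ0.le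
  have h5 := mul_lt_mul_of_pos_left hlt (pow_pos hε 2)
  linarith

theorem inv_betaZero_le_paretoSlope (P : Measure (𝒳 × 𝒴)) [IsProbabilityMeasure P] {Ω : Set 𝒳}
    (hΩ : MeasurableSet Ω) (h0 : 0 < probX P Ω) (h1 : probX P Ω < 1) :
    (betaZero P Ω)⁻¹ ≤ paretoSlope P := by
  have hV : 0 < probX P Ω * (1 - probX P Ω) := mul_pos h0 (by linarith)
  have hn : 0 < 1 / probX P Ω - 1 := sub_pos.2 ((one_lt_div h0).2 h1)
  rw [betaZero, ENNReal.inv_div (Or.inl ENNReal.ofReal_ne_top) (Or.inr (by simpa using hn)),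
    ← ENNReal.ofReal_div_of_pos hn]
  refine le_of_forall_lt_imp_le_of_dense fun c hc => ?_
  lift c to NNReal using hc.ne_top
  rw [ENNReal.lt_ofReal_iff_toReal_lt ENNReal.coe_ne_top, ENNReal.coe_toReal,
    lt_div_iff₀ hn] at hc
  have hc0 : (0 : ℝ) ≤ c := c.2
  have hVW : c * (probX P Ω * (1 - probX P Ω)) < probX P Ω ^ 2 * ratioExpectation P Ω := by
    have h := mul_lt_mul_of_pos_left hc (pow_pos h0 2)
    have e : probX P Ω ^ 2 * (c * (1 / probX P Ω - 1)) =
      c * (probX P Ω * (1 - probX P Ω)) := by field_simp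
    linarith
  obtain ⟨δ, hδ, hδ', hlt⟩ := exists_half_add_mul_lt (by positivity) hVW
  set V := probX P Ω * (1 - probX P Ω) with hVdef
  set W := probX P Ω ^ 2 * ratioExpectation P Ω with hWdef
  have hW : 0 ≤ W := le_trans (by positivity) hVW.le
  refine le_liminf_of_le (by isBoundedDefault) ?_
  have hr0 : (0 : ℝ≥0∞) < ENNReal.ofReal ((1 / 2 + 4 * δ) * (δ ^ 2 * V)) :=
    ENNReal.ofReal_pos.2 (by positivity)
  filter_upwards [Ioo_mem_nhdsGT hr0] with r hr
  lift r to NNReal using (hr.2.trans ENNReal.ofReal_lt_top).ne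
  have hr2 := (ENNReal.lt_ofReal_iff_toReal_lt ENNReal.coe_ne_top).1 hr.2
  rw [ENNReal.coe_toReal] at hr2
  have hK : 0 < (1 / 2 + 4 * δ) * V := by positivity
  -- With the fixed `δ` in the prefactor, `(1/2 + 4δ) ε² V = r` is solved by a square root. As `ε ≤
  -- δ`, the errors at `ε` are no worse than those at `δ`, so both bounds survive.
  obtain ⟨ε, hε0, hsq, hle⟩ : ∃ ε : ℝ, 0 ≤ ε ∧ ε ^ 2 = r / ((1 / 2 + 4 * δ) * V) ∧ ε ≤ δ := by
    refine ⟨Real.sqrt (r / ((1 / 2 + 4 * δ) * V)), Real.sqrt_nonneg _,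
      Real.sq_sqrt (div_nonneg r.2 hK.le), ?_⟩
    rw [Real.sqrt_le_left hδ.le, div_le_iff₀ hK]
    linarith
  have hr3 : (1 / 2 + 4 * δ) * (ε ^ 2 * V) = r := by
    rw [hsq]
    field_simp
  obtain ⟨R, hX, -, hY⟩ := exists_representation P hΩ h0 h1 hε0
    (by linarith : ε ≤ 1 / 8)
  rw [← hVdef] at hX
  rw [← hWdef] at hY
  have hXr : infoXZ P R ≤ r := by
    refine hX.trans ?_
    rw [← ENNReal.ofReal_coe_nnreal, ← hr3]
    exact ENNReal.ofReal_le_ofReal (by gcongr)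
  have hYr : (c : ℝ≥0∞) * r ≤ infoYZ P R := by
    refine le_trans ?_ hY
    rw [← ENNReal.coe_mul, ← ENNReal.ofReal_coe_nnreal, NNReal.coe_mul, ← hr3]
    refine ENNReal.ofReal_le_ofReal ?_
    have i1 := mul_le_mul_of_nonneg_left hlt.le (sq_nonneg ε)
    have i2 : (1 / 2 - 4 * δ) * (ε ^ 2 * W) ≤ (1 / 2 - 4 * ε) * (ε ^ 2 * W) := by gcongr
    linarith
  rw [paretoFrontier_zero, tsub_zero, ENNReal.le_div_iff_mul_le (Or.inl hr.1.ne')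
    (Or.inl ENNReal.coe_ne_top)]
  exact hYr.trans (le_iSup₂ (f := fun (R : Representation 𝒳) (_ : infoXZ P R ≤ r) => infoYZ P R)
    R hXr)

theorem inv_infBetaZero_le_paretoSlope (P : Measure (𝒳 × 𝒴)) [IsProbabilityMeasure P] :
    (infBetaZero P)⁻¹ ≤ paretoSlope P := by
  rw [ENNReal.inv_le_iff_inv_le, infBetaZero]
  refine le_iInf fun Ω => le_iInf fun hΩ => le_iInf fun h0 => le_iInf fun h1 => ?_
  rw [ENNReal.inv_le_iff_inv_le]
  exact inv_betaZero_le_paretoSlope P hΩ h0 h1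

/-! ### Invariance under measurable embeddings of `X` -/

section Map

variable {𝒳' : Type*} [MeasurableSpace 𝒳'] (P : Measure (𝒳 × 𝒴)) {g : 𝒳 → 𝒳'}

theorem probX_mapX (hg : Measurable g) {Ω : Set 𝒳'} (hΩ : MeasurableSet Ω) :
    probX (mapX g P) Ω = probX P (g ⁻¹' Ω) := by
  have hm : Measurable fun p : 𝒳 × 𝒴 => (g p.1, p.2) := by fun_prop
  rw [probX, probX, measureReal_def, measureReal_def, mapX, Measure.fst_apply hΩ,
    Measure.fst_apply (hg hΩ), Measure.map_apply hm (measurable_fst hΩ)]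
  rfl

theorem snd_mapX (hg : Measurable g) : (mapX g P).snd = P.snd := by
  rw [mapX, Measure.snd, Measure.map_map measurable_snd (by fun_prop)]
  rfl

theorem condY_mapX (hg : Measurable g) {Ω : Set 𝒳'} (hΩ : MeasurableSet Ω) :
    condY (mapX g P) Ω = condY P (g ⁻¹' Ω) := by
  have hm : Measurable fun p : 𝒳 × 𝒴 => (g p.1, p.2) := by fun_prop
  ext s hs
  rw [condY, condY, Measure.snd_apply hs, Measure.snd_apply hs, cond_apply (measurable_fst hΩ),
    cond_apply (measurable_fst (hg hΩ)), mapX, Measure.map_apply hm (measurable_fst hΩ),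
    Measure.map_apply hm ((measurable_fst hΩ).inter (measurable_snd hs))]
  rfl

theorem betaZero_mapX (hg : Measurable g) {Ω : Set 𝒳'} (hΩ : MeasurableSet Ω) :
    betaZero (mapX g P) Ω = betaZero P (g ⁻¹' Ω) := by
  rw [betaZero, betaZero, ratioExpectation, ratioExpectation, probX_mapX P hg hΩ,
    condY_mapX P hg hΩ, snd_mapX P hg]

theorem betaZero_mapX_image (hg : MeasurableEmbedding g) {Ω : Set 𝒳} (hΩ : MeasurableSet Ω) :
    betaZero (mapX g P) (g '' Ω) = betaZero P Ω := by
  rw [betaZero_mapX P hg.measurable (hg.measurableSet_image.2 hΩ),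
    Set.preimage_image_eq _ hg.injective]

/-- Images under `g` give one inequality, preimages the other; both preserve measurability, `p(Ω)`
and `β₀(Ω)`. -/
theorem infBetaZero_mapX (hg : MeasurableEmbedding g) :
    infBetaZero (mapX g P) = infBetaZero P := by
  refine le_antisymm ?_ ?_
  · refine le_iInf fun Ω => le_iInf fun hΩ => le_iInf fun h0 => le_iInf fun h1 => ?_
    have hm := hg.measurableSet_image.2 hΩ
    have hp : probX (mapX g P) (g '' Ω) = probX P Ω := by
      rw [probX_mapX P hg.measurable hm, Set.preimage_image_eq _ hg.injective]
    rw [← betaZero_mapX_image P hg hΩ]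
    exact iInf_le_of_le _ (iInf_le_of_le hm (iInf_le_of_le (hp ▸ h0) (iInf_le _ (hp ▸ h1))))
  · refine le_iInf fun Ω => le_iInf fun hΩ => le_iInf fun h0 => le_iInf fun h1 => ?_
    have hp := probX_mapX P hg.measurable hΩ
    rw [betaZero_mapX P hg.measurable hΩ]
    exact iInf_le_of_le _ (iInf_le_of_le (hg.measurable hΩ)
      (iInf_le_of_le (hp ▸ h0) (iInf_le _ (hp ▸ h1))))

/-- Every measurable `s` is the preimage of the measurable set `g '' s`, so `g(X)` and `X` generate
the same events. -/
theorem indepFun_mapX_iff (hg : MeasurableEmbedding g) :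
    IndepFun Prod.fst Prod.snd (mapX g P) ↔ IndepFun Prod.fst Prod.snd P := by
  have hm : Measurable fun p : 𝒳 × 𝒴 => (g p.1, p.2) := by
    have := hg.measurable
    fun_prop
  simp only [indepFun_iff_measure_inter_preimage_eq_mul]
  have key : ∀ (s : Set 𝒳') (t : Set 𝒴), MeasurableSet s → MeasurableSet t →
      ((mapX g P (Prod.fst ⁻¹' s ∩ Prod.snd ⁻¹' t) =
        mapX g P (Prod.fst ⁻¹' s) * mapX g P (Prod.snd ⁻¹' t)) ↔
      P (Prod.fst ⁻¹' (g ⁻¹' s) ∩ Prod.snd ⁻¹' t) =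
        P (Prod.fst ⁻¹' (g ⁻¹' s)) * P (Prod.snd ⁻¹' t)) := fun s t hs ht => by
    rw [mapX, Measure.map_apply hm ((measurable_fst hs).inter (measurable_snd ht)),
      Measure.map_apply hm (measurable_fst hs), Measure.map_apply hm (measurable_snd ht)]
    rfl
  refine ⟨fun h s t hs ht => ?_, fun h s t hs ht => (key s t hs ht).2 (h _ t (hg.measurable hs) ht)⟩
  have h2 := (key (g '' s) t (hg.measurableSet_image.2 hs) ht).1
    (h _ t (hg.measurableSet_image.2 hs) ht)
  rwa [Set.preimage_image_eq _ hg.injective] at h2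

end Map

end IBLearn

theorem mainTheorem1 {𝒳 𝒴 : Type*} [MeasurableSpace 𝒳] [MeasurableSpace 𝒴]
    (P : Measure (𝒳 × 𝒴)) [IsProbabilityMeasure P] :
    -- sufficient condition for learnability
    (∀ β : ℝ, IBLearn.ConspicuousCondition P β →
      IBLearn.Learnable P β) ∧
    -- lower bound on the slope of the Pareto frontier at the origin
    (IBLearn.infBetaZero P)⁻¹ ≤ IBLearn.paretoSlope P ∧
    -- invariance under invertible maps of `X`
    (∀ {𝒳' : Type*} [MeasurableSpace 𝒳'] (g : 𝒳 → 𝒳'), MeasurableEmbedding g →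
      (∀ Ω : Set 𝒳, MeasurableSet Ω →
        IBLearn.betaZero (IBLearn.mapX g P) (g '' Ω) = IBLearn.betaZero P Ω) ∧
      IBLearn.infBetaZero (IBLearn.mapX g P) = IBLearn.infBetaZero P ∧
      ∀ β : ℝ, IBLearn.ConspicuousCondition (IBLearn.mapX g P) β ↔
        IBLearn.ConspicuousCondition P β) := by
  refine ⟨fun β hβ => ?_, IBLearn.inv_infBetaZero_le_paretoSlope P, fun g hg =>
    ⟨fun Ω hΩ => IBLearn.betaZero_mapX_image P hg hΩ, IBLearn.infBetaZero_mapX P hg, fun β => ?_⟩⟩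
  · have h := hβ.2
    simp only [IBLearn.infBetaZero, iInf_lt_iff] at h
    obtain ⟨Ω, hΩ, h0, h1, h⟩ := h
    exact IBLearn.learnable_of_betaZero_lt P hΩ h0 h1 h
  · rw [IBLearn.ConspicuousCondition, IBLearn.ConspicuousCondition,
      IBLearn.indepFun_mapX_iff P hg, IBLearn.infBetaZero_mapX P hg]
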